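/- Let $C=\{0,1\}^\infty$ be the Cantor set of infinite binary sequences with the product topology, and $C^2=C\times C$. For finite binary words $\alpha,\beta$ let $R(\alpha,\beta)=\{(\alpha\psi,\beta\omega) : \psi,\omega\in C\}$ be the corresponding dyadic rectangle; a dyadic subdivision of $C^2$ is a partition of $C^2$ into finitely many dyadic rectangles. The Brin--Thompson group $2V$ is the group of all homeomorphisms $f\colon C^2\to C^2$ for which there is a dyadic subdivision of $C^2$ such that $f$ acts on each of its rectangles $R(\alpha,\beta)$ as a prefix replacement $(\alpha\psi,\beta\omega)\mapsto(\gamma\psi,\delta\omega)$ for some finite words $\gamma,\delta$. An element $f\in 2V$ is specified by a numbered pattern pair, i.e. a finite list of pairs of dyadic rectangles $\bigl(R(\alpha_i,\beta_i),R(\gamma_i,\delta_i)\bigr)$ such that the $R(\alpha_i,\beta_i)$ form a dyadic subdivision, the $R(\gamma_i,\delta_i)$ form a dyadic subdivision, and $f(\alpha_i\psi,\beta_i\omega)=(\gamma_i\psi,\delta_i\omega)$ for all $i$ and all $\psi,\omega\in C$. A point $(\psi,\omega)\in C^2$ is dyadic if $\psi$ and $\omega$ contain only finitely many $1$'s; it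 is specified by finite words $\alpha,\beta$ with $(\psi,\omega)=(\alpha\overline{0},\beta\overline{0})$. Theorem. It is not decidable, given an element $f\in 2V$ and two dyadic points $p,q\in C^2$, whether the orbit of $p$ under $f$ converges to $q$. That is, there is no algorithm (partial recursive function) which, given any numbered pattern pair for an element $f\in 2V$ and any finite words specifying dyadic points $p,q\in C^2$, always halts and correctly answers whether $f^n(p)\to q$ as $n\to\infty$. -/

import Mathlib

namespace BrinThompson

/-- Finite binary sequences, the elements of `{0,1}^*` (`true` is the digit `1`). -/
abbrev Word : Type := List Bool

/-- The Cantor set `C = {0,1}^∞`, with the product topology. -/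
abbrev Cantor : Type := ℕ → Bool

/-- The Cantor square `C² = C × C`, with the product topology. -/
abbrev CantorSq : Type := Cantor × Cantor

/-- The concatenation `αω` of a finite sequence `α` and an infinite sequence `ω`. -/
def cat (α : Word) (ω : Cantor) : Cantor :=
  fun n => if h : n < α.length then α[n] else ω (n - α.length)

/-- The dyadic interval `I(α)` of all infinite sequences that begin with `α`. -/
def interval (α : Word) : Set Cantor := Set.range (cat α)

/-- The dyadic rectangle `R(α,β) = I(α) × I(β)`, named by the pair `(α,β)`. -/
def rect (r : Word × Word) : Set CantorSq := interval r.1 ×ˢ interval r.2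

/-- The rectangles named in the list `D` form a dyadic subdivision of `C²`: they are pairwise
disjoint and they cover `C²`. -/
def IsSubdivision (D : List (Word × Word)) : Prop :=
  D.Pairwise (fun r s => Disjoint (rect r) (rect s)) ∧ ∀ x : CantorSq, ∃ r ∈ D, x ∈ rect r

/-- On the rectangle `R(α,β)`, `r = (α,β)`, the map `f` is the prefix replacement
`(αψ, βω) ↦ (γψ, δω)` onto `R(γ,δ)`, `s = (γ,δ)`. -/
def ActsAsPrefixReplacement (f : CantorSq → CantorSq) (r s : Word × Word) : Prop :=
  ∀ ψ ω : Cantor, f (cat r.1 ψ, cat r.2 ω) = (cat s.1 ψ, cat s.2 ω)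

/-- The defining property of the elements of `2V`. -/
def IsPiecewisePrefixReplacement (f : CantorSq ≃ₜ CantorSq) : Prop :=
  ∃ D : List (Word × Word), IsSubdivision D ∧
    ∀ r ∈ D, ∃ s : Word × Word, ActsAsPrefixReplacement f r s

/-! Facts needed to see that these homeomorphisms form a group. -/

theorem cat_nil (ω : Cantor) : cat [] ω = ω := by
  funext n; simp [cat]

theorem cat_append (α β : Word) (ω : Cantor) : cat (α ++ β) ω = cat α (cat β ω) := by
  funext n
  simp only [cat, List.length_append, List.getElem_append]
  split_ifs <;> first | rfl | omega | (congr 1; omega)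

theorem cat_take_drop (n : ℕ) (ω : Cantor) :
    cat (List.ofFn fun i : Fin n => ω i) (fun k => ω (n + k)) = ω := by
  funext k
  simp only [cat, List.length_ofFn, List.getElem_ofFn]
  split_ifs
  · rfl
  · congr 1; omega

theorem exists_append_of_cat_eq {α β : Word} {ψ ω : Cantor} (h : cat α ψ = cat β ω)
    (hl : β.length ≤ α.length) : ∃ a : Word, α = β ++ a := by
  refine ⟨α.drop β.length, ?_⟩
  have hβ : α.take β.length = β := by
    apply List.ext_getElem
    · simp [hl]
    · intro n h1 h2
      have := congrFun h n
      have h3 : n < α.length := by omega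
      simp only [cat, h2, h3, dif_pos] at this
      simpa using this
  conv_lhs => rw [← List.take_append_drop β.length α, hβ]

/-- All pairs of words of length `n`. -/
noncomputable def grid (n : ℕ) : List (Word × Word) :=
  (Finset.univ : Finset ((Fin n → Bool) × (Fin n → Bool))).toList.map
    (fun v => (List.ofFn v.1, List.ofFn v.2))

theorem mem_grid {n : ℕ} {r : Word × Word} :
    r ∈ grid n ↔ r.1.length = n ∧ r.2.length = n := by
  obtain ⟨α, β⟩ := r
  simp only [grid, List.mem_map, Finset.mem_toList, Finset.mem_univ, true_and, Prod.exists,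
    Prod.mk.injEq]
  constructor
  · rintro ⟨v, w, rfl, rfl⟩; simp
  · rintro ⟨h1, h2⟩
    subst h1
    refine ⟨fun i => α[i], fun i => β[i], ?_, ?_⟩
    · apply List.ext_getElem <;> simp
    · apply List.ext_getElem <;> simp [h2]

theorem isSubdivision_grid (n : ℕ) : IsSubdivision (grid n) := by
  constructor
  · have hnd : (grid n).Nodup := by
      refine List.Nodup.map ?_ (Finset.nodup_toList _)
      rintro ⟨a, b⟩ ⟨c, d⟩ h
      simp only [Prod.mk.injEq, List.ofFn_inj] at h
      rw [h.1, h.2]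
    refine List.Pairwise.imp_of_mem ?_ hnd
    rintro ⟨α, β⟩ ⟨γ, δ⟩ hr hs hne
    rw [mem_grid] at hr hs
    rw [Set.disjoint_left]
    rintro ⟨x, y⟩ ⟨⟨ψ, h1⟩, ω, h2⟩ ⟨⟨ψ', h3⟩, ω', h4⟩
    apply hne
    obtain ⟨a, ha⟩ := exists_append_of_cat_eq (h1.trans h3.symm) (by simp_all)
    obtain ⟨b, hb⟩ := exists_append_of_cat_eq (h2.trans h4.symm) (by simp_all)
    have la := congrArg List.length ha
    have lb := congrArg List.length hb
    simp only [List.length_append] at la lb hr hs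
    have ha' : a = [] := List.length_eq_zero_iff.mp (by omega)
    have hb' : b = [] := List.length_eq_zero_iff.mp (by omega)
    subst ha' hb'
    simpa using And.intro ha hb
  · rintro ⟨x, y⟩
    exact ⟨(List.ofFn fun i : Fin n => x i, List.ofFn fun i : Fin n => y i),
      mem_grid.mpr (by simp), ⟨_, cat_take_drop n x⟩, ⟨_, cat_take_drop n y⟩⟩

theorem exists_length_bound (D : List (Word × Word)) :
    ∃ n : ℕ, ∀ r ∈ D, r.1.length ≤ n ∧ r.2.length ≤ n := by
  induction D with
  | nil => exact ⟨0, by simp⟩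
  | cons r D ih =>
    obtain ⟨n, hn⟩ := ih
    refine ⟨n + r.1.length + r.2.length, ?_⟩
    intro s hs
    rcases List.mem_cons.mp hs with rfl | hs
    · omega
    · have := hn s hs
      omega

theorem ActsAsPrefixReplacement.extend {f : CantorSq → CantorSq} {α β γ δ : Word}
    (h : ActsAsPrefixReplacement f (α, β) (γ, δ)) (a b : Word) :
    ActsAsPrefixReplacement f (α ++ a, β ++ b) (γ ++ a, δ ++ b) := by
  intro ψ ω
  simp only [cat_append]
  exact h _ _

theorem isPiecewisePrefixReplacement_iff (f : CantorSq ≃ₜ CantorSq) :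
    IsPiecewisePrefixReplacement f ↔ ∃ n : ℕ, ∀ α β : Word, n ≤ α.length → n ≤ β.length →
      ∃ s : Word × Word, ActsAsPrefixReplacement f (α, β) s := by
  constructor
  · rintro ⟨D, hD, hf⟩
    obtain ⟨n, hn⟩ := exists_length_bound D
    refine ⟨n, fun α β hα hβ => ?_⟩
    obtain ⟨⟨α', β'⟩, hr, ⟨ψ, h1⟩, ω, h2⟩ :=
      hD.2 (cat α (fun _ => false), cat β (fun _ => false))
    obtain ⟨h3, h4⟩ := hn _ hr
    replace h1 : cat α' ψ = cat α (fun _ => false) := h1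
    replace h2 : cat β' ω = cat β (fun _ => false) := h2
    obtain ⟨a, rfl⟩ := exists_append_of_cat_eq (β := α') h1.symm (h3.trans hα)
    obtain ⟨b, rfl⟩ := exists_append_of_cat_eq (β := β') h2.symm (h4.trans hβ)
    obtain ⟨s, hs⟩ := hf _ hr
    exact ⟨_, ActsAsPrefixReplacement.extend hs a b⟩
  · rintro ⟨n, hn⟩
    refine ⟨grid n, isSubdivision_grid n, fun r hr => ?_⟩
    obtain ⟨h1, h2⟩ := mem_grid.mp hr
    exact hn r.1 r.2 h1.ge h2.ge

/-- The Brin-Thompson group `2V`: the group of all homeomorphisms `f` of `C²` for which there is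
a dyadic subdivision of `C²` such that `f` acts as a prefix replacement on each of its
rectangles. -/
def TwoV : Subgroup (CantorSq ≃ₜ CantorSq) where
  carrier := {f | IsPiecewisePrefixReplacement f}
  one_mem' := (isPiecewisePrefixReplacement_iff _).mpr
    ⟨0, fun α β _ _ => ⟨(α, β), fun _ _ => rfl⟩⟩
  mul_mem' := by
    intro f g hf hg
    simp only [Set.mem_ofPred_eq, isPiecewisePrefixReplacement_iff] at hf hg ⊢
    obtain ⟨m, hm⟩ := hf
    obtain ⟨n, hn⟩ := hg
    refine ⟨n + m, fun α β hα hβ => ?_⟩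
    obtain ⟨⟨γ, δ⟩, hs⟩ := hn (α.take n) (β.take n) (by simp; omega) (by simp; omega)
    have hs' := hs.extend (α.drop n) (β.drop n)
    rw [List.take_append_drop, List.take_append_drop] at hs'
    obtain ⟨t, ht⟩ := hm (γ ++ α.drop n) (δ ++ β.drop n) (by simp; omega) (by simp; omega)
    exact ⟨t, fun ψ ω => (congrArg f (hs' ψ ω)).trans (ht ψ ω)⟩
  inv_mem' := by
    intro f hf
    simp only [Set.mem_ofPred_eq] at hf ⊢
    obtain ⟨D, hD, hf⟩ := hf
    choose! s hs using hf
    obtain ⟨n, hn⟩ := exists_length_bound (D.map s)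
    refine (isPiecewisePrefixReplacement_iff _).mpr ⟨n, fun α β hα hβ => ?_⟩
    obtain ⟨r, hr, ⟨ψ, h1⟩, ω, h2⟩ :=
      hD.2 (f.symm (cat α (fun _ => false), cat β (fun _ => false)))
    have h3 : f (cat r.1 ψ, cat r.2 ω) = (cat α (fun _ => false), cat β (fun _ => false)) := by
      rw [h1, h2]; exact f.apply_symm_apply _
    rw [hs r hr, Prod.mk.injEq] at h3
    obtain ⟨h4, h5⟩ := hn (s r) (List.mem_map_of_mem hr)
    obtain ⟨a, ha⟩ := exists_append_of_cat_eq h3.1.symm (h4.trans hα)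
    obtain ⟨b, hb⟩ := exists_append_of_cat_eq h3.2.symm (h5.trans hβ)
    refine ⟨(r.1 ++ a, r.2 ++ b), fun ψ ω => ?_⟩
    have h6 := (hs r hr).extend a b ψ ω
    simp only [← ha, ← hb] at h6
    exact f.symm_apply_eq.mpr h6.symm

/-- A finite description of an element of `2V` by a numbered pattern pair: the `i`-th entry
`(r, s)` consists of (the name of) the `i`-th rectangle of the domain pattern and that of the
`i`-th rectangle of the range pattern. -/
abbrev PatternPair : Type := List ((Word × Word) × (Word × Word))

/-- `P` is a numbered pattern pair for `f`: its first and its second components each form a dyadic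
subdivision of `C²`, and `f` maps each rectangle of the first onto the rectangle of the second
with the same number by prefix replacement. -/
def PatternPair.Represents (P : PatternPair) (f : CantorSq ≃ₜ CantorSq) : Prop :=
  IsSubdivision (P.map Prod.fst) ∧ IsSubdivision (P.map Prod.snd) ∧
    ∀ e ∈ P, ActsAsPrefixReplacement f e.1 e.2

/-- A point `(ψ, ω)` of `C²` is dyadic if `ψ` and `ω` have only finitely many `1`'s. -/
def IsDyadic (p : CantorSq) : Prop :=
  {n : ℕ | p.1 n = true}.Finite ∧ {n : ℕ | p.2 n = true}.Finite

/-- The pair of finite words `u = (α, β)` is a name of the dyadic point `p = (α000…, β000…)`. -/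
def Names (u : Word × Word) (p : CantorSq) : Prop :=
  p = (cat u.1 (fun _ => false), cat u.2 (fun _ => false))

/-- The (forward) orbit `p, f p, f (f p), …` converges to `q`. -/
def OrbitConvergesTo (f : CantorSq ≃ₜ CantorSq) (p q : CantorSq) : Prop :=
  Filter.Tendsto (fun n : ℕ => (⇑f)^[n] p) Filter.atTop (nhds q)

/-- The algorithm `A` decides, given an element `f` of `2V` (by any numbered pattern pair) and
dyadic points `p`, `q` (by finite words), whether the orbit of `p` under `f` converges to `q`: on
every such input it halts with the correct answer. Nothing is asked of `A` on other inputs. -/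
def DecidesOrbitConvergence (A : PatternPair × (Word × Word) × (Word × Word) →. Bool) : Prop :=
  ∀ f ∈ TwoV, ∀ p q : CantorSq, IsDyadic p → IsDyadic q →
    ∀ (P : PatternPair) (u v : Word × Word), P.Represents f → Names u p → Names v q →
      ∃ b ∈ A (P, u, v), (b = true ↔ OrbitConvergesTo f p q)

end BrinThompson

/-! ### Completing a partial prefix replacement to an element of `2V`. -/

namespace BrinThompson

/-! The halting problem reduces to orbit convergence for one fixed element `f` of `2V`. A point of
`C²` is a pair of infinite tapes, and `f` rewrites prefixes of both. Any finite list of prefix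
rewriting rules, with pairwise disjoint domain rectangles and pairwise disjoint range rectangles,
extends to an element of `2V` as long as neither side covers `C²` (`exists_patternPair_extending`,
`exists_homeomorph_represents`).

Since `f` is invertible, the simulated computation has to be reversible. The machine is a stack
machine: all its stacks lie one after the other on the second tape, and the first tape is used as a
pushdown. To execute a step, the head walks to the selected stack, moving the letters it passes onto
the first tape, rewrites the top, walks back, and leaves a history letter recording the information
that would otherwise be lost (`Rule`, `transGen_of_stackStep`). A halting run falls into a sink
state which inserts zeros on both tapes forever, so the orbit converges to a known dyadic point. A
run that does not halt returns to a `main` state infinitely often, and so keeps leaving a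
neighbourhood of that point (`exists_orbitConvergesTo_iff_eval_dom`).

The stack machine is a finite part of the `TM2` machine evaluating a universal partial recursive
function. Only the starting point depends on the program, and its name is computable. -/

theorem cat_injective (α : Word) : Function.Injective (cat α) := by
  intro ψ ω h
  funext n
  simpa [cat] using congrFun h (α.length + n)

theorem continuous_cat (α : Word) : Continuous (cat α) := by
  refine continuous_pi fun n => ?_
  by_cases h : n < α.length
  · simpa [cat, h] using continuous_const
  · simpa [cat, h] using continuous_apply (n - α.length)

/-- The infinite sequence left after removing `n` digits. -/
def drop (n : ℕ) (x : Cantor) : Cantor := fun k => x (n + k)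

theorem continuous_drop (n : ℕ) : Continuous (drop n) :=
  continuous_pi fun k => continuous_apply (n + k)

theorem drop_cat (α : Word) (ω : Cantor) : drop α.length (cat α ω) = ω := by
  funext k; simp [drop, cat]

theorem mem_interval_iff {α : Word} {x : Cantor} :
    x ∈ interval α ↔ ∀ (n : ℕ) (h : n < α.length), x n = α[n] := by
  constructor
  · rintro ⟨ω, rfl⟩ n h
    simp [cat, h]
  · intro h
    refine ⟨drop α.length x, ?_⟩
    funext n
    by_cases hn : n < α.length
    · simp [cat, hn, h n hn]
    · simp only [cat, hn, dif_neg, not_false_eq_true, drop]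
      congr 1; omega

theorem isClopen_interval (α : Word) : IsClopen (interval α) := by
  have : interval α = ⋂ i : Fin α.length, (fun x : Cantor => x i) ⁻¹' {α[i]} := by
    ext x
    simp only [mem_interval_iff, Set.mem_iInter, Set.mem_preimage, Set.mem_singleton_iff]
    exact ⟨fun h i => h i i.2, fun h n hn => h ⟨n, hn⟩⟩
  rw [this]
  exact isClopen_iInter_of_finite fun i =>
    (isClopen_discrete _).preimage (continuous_apply (i : ℕ))

theorem isClopen_rect (r : Word × Word) : IsClopen (rect r) :=
  (isClopen_interval _).prod (isClopen_interval _)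

theorem interval_append_subset (α β : Word) : interval (α ++ β) ⊆ interval α := by
  rintro _ ⟨ω, rfl⟩
  exact ⟨cat β ω, (cat_append α β ω).symm⟩

theorem interval_subset_or_disjoint {α β : Word} (h : β.length ≤ α.length) :
    interval α ⊆ interval β ∨ Disjoint (interval α) (interval β) := by
  by_cases hd : Disjoint (interval α) (interval β)
  · exact Or.inr hd
  · obtain ⟨x, ⟨ψ, h1⟩, ω, h2⟩ := Set.not_disjoint_iff.mp hd
    obtain ⟨a, rfl⟩ := exists_append_of_cat_eq (h1.trans h2.symm) h
    exact Or.inl (interval_append_subset _ _)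

theorem rect_subset_or_disjoint {r s : Word × Word} (h1 : s.1.length ≤ r.1.length)
    (h2 : s.2.length ≤ r.2.length) : rect r ⊆ rect s ∨ Disjoint (rect r) (rect s) := by
  rcases interval_subset_or_disjoint h1 with h1 | h1
  · rcases interval_subset_or_disjoint h2 with h2 | h2
    · exact Or.inl (Set.prod_mono h1 h2)
    · exact Or.inr (Set.disjoint_prod.mpr (Or.inr h2))
  · exact Or.inr (Set.disjoint_prod.mpr (Or.inl h1))

/-- Pairwise disjoint dyadic rectangles can be completed to a dyadic subdivision. -/
theorem exists_isSubdivision_append {L : List (Word × Word)}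
    (hL : L.Pairwise fun r s => Disjoint (rect r) (rect s)) :
    ∃ D, IsSubdivision (D ++ L) := by
  classical
  obtain ⟨n, hn⟩ := exists_length_bound L
  -- The grid is at least as fine as every rectangle of `L`, so each grid square lies inside a given
  -- rectangle or misses it. The squares missing all of them fill the complement.
  refine ⟨(grid n).filter fun r => ∀ s ∈ L, Disjoint (rect r) (rect s), ?_, fun x => ?_⟩
  · refine List.pairwise_append.mpr ⟨(isSubdivision_grid n).1.filter _, hL, ?_⟩
    intro r hr s hs
    exact of_decide_eq_true (List.mem_filter.mp hr).2 s hs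
  · obtain ⟨r, hr, hx⟩ := (isSubdivision_grid n).2 x
    by_cases h : ∀ s ∈ L, Disjoint (rect r) (rect s)
    · exact ⟨r, List.mem_append_left _ (List.mem_filter.mpr ⟨hr, by simpa using h⟩), hx⟩
    · push Not at h
      obtain ⟨s, hs, hd⟩ := h
      obtain ⟨h1, h2⟩ := mem_grid.mp hr
      obtain ⟨h3, h4⟩ := hn s hs
      rcases rect_subset_or_disjoint (h3.trans h1.ge) (h4.trans h2.ge) with h | h
      · exact ⟨s, List.mem_append_right _ hs, h hx⟩
      · exact absurd h hd

theorem interval_split (α : Word) :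
    interval α = interval (α ++ [false]) ∪ interval (α ++ [true]) := by
  refine Set.Subset.antisymm ?_
    (Set.union_subset (interval_append_subset _ _) (interval_append_subset _ _))
  rintro _ ⟨ω, rfl⟩
  have h : cat [ω 0] (drop 1 ω) = ω := by
    have := cat_take_drop 1 ω
    rwa [List.ofFn_succ, List.ofFn_zero] at this
  cases h0 : ω 0 <;> rw [h0] at h
  · exact Or.inl ⟨drop 1 ω, by rw [cat_append, h]⟩
  · exact Or.inr ⟨drop 1 ω, by rw [cat_append, h]⟩

theorem disjoint_interval_of_getElem {α β : Word} (n : ℕ) (h1 : n < α.length) (h2 : n < β.length)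
    (h : α[n] ≠ β[n]) : Disjoint (interval α) (interval β) :=
  Set.disjoint_left.mpr fun _ hα hβ =>
    h ((mem_interval_iff.mp hα n h1).symm.trans (mem_interval_iff.mp hβ n h2))

theorem IsSubdivision.split {α β : Word} {D : List (Word × Word)}
    (h : IsSubdivision ((α, β) :: D)) :
    IsSubdivision ((α ++ [false], β) :: (α ++ [true], β) :: D) := by
  obtain ⟨h1, h2⟩ := h
  rw [List.pairwise_cons] at h1
  have hs : ∀ b, rect (α ++ [b], β) ⊆ rect (α, β) := fun b =>
    Set.prod_mono (interval_append_subset _ _) subset_rfl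
  refine ⟨?_, fun x => ?_⟩
  · simp only [List.pairwise_cons, List.mem_cons, forall_eq_or_imp]
    refine ⟨⟨?_, fun s hs' => (h1.1 s hs').mono_left (hs _)⟩,
      fun s hs' => (h1.1 s hs').mono_left (hs _), h1.2⟩
    exact Set.disjoint_prod.mpr
      (Or.inl (disjoint_interval_of_getElem α.length (by simp) (by simp) (by simp)))
  · obtain ⟨r, hr, hx⟩ := h2 x
    rcases List.mem_cons.mp hr with rfl | hr
    · have hx1 := hx.1
      simp only [interval_split α] at hx1
      rcases hx1 with hx1 | hx1
      · exact ⟨_, List.mem_cons_self, hx1, hx.2⟩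
      · exact ⟨_, List.mem_cons_of_mem _ List.mem_cons_self, hx1, hx.2⟩
    · exact ⟨r, by simp [hr], hx⟩

/-- Halving a rectangle of `D` raises the count by exactly one, so every larger count is reached.
This needs at least one rectangle to halve. -/
theorem IsSubdivision.exists_length_eq {D L : List (Word × Word)} (h : IsSubdivision (D ++ L))
    (hD : D ≠ []) {m : ℕ} (hm : D.length ≤ m) :
    ∃ D', D'.length = m ∧ IsSubdivision (D' ++ L) := by
  induction m, hm using Nat.le_induction with
  | base => exact ⟨D, rfl, h⟩
  | succ m hm ih =>
    obtain ⟨D', rfl, h'⟩ := ih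
    cases D' with
    | nil => exact absurd (List.length_eq_zero_iff.mp (Nat.le_zero.mp hm)) hD
    | cons r D' => exact ⟨(_, _) :: (_, _) :: D', by simp, IsSubdivision.split (D := D' ++ L) h'⟩

/-- A partial numbered pattern pair that is not total can be completed to a pattern pair. -/
theorem exists_patternPair_extending {T : PatternPair}
    (hd : T.Pairwise fun e e' => Disjoint (rect e.1) (rect e'.1))
    (hr : T.Pairwise fun e e' => Disjoint (rect e.2) (rect e'.2))
    (hd' : ∃ x, ∀ e ∈ T, x ∉ rect e.1) (hr' : ∃ x, ∀ e ∈ T, x ∉ rect e.2) :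
    ∃ P : PatternPair, (∀ e ∈ T, e ∈ P) ∧ IsSubdivision (P.map Prod.fst) ∧
      IsSubdivision (P.map Prod.snd) := by
  -- An uncovered point forces the completing list to be nonempty. Both completions can then be
  -- refined to a common length and matched arbitrarily.
  have key : ∀ g : (Word × Word) × (Word × Word) → Word × Word,
      (T.Pairwise fun e e' => Disjoint (rect (g e)) (rect (g e'))) →
      (∃ x, ∀ e ∈ T, x ∉ rect (g e)) → ∃ D ≠ [], IsSubdivision (D ++ T.map g) := by
    rintro g h ⟨x, hx⟩
    obtain ⟨D, hD⟩ := exists_isSubdivision_append (List.pairwise_map.mpr h)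
    refine ⟨D, ?_, hD⟩
    rintro rfl
    obtain ⟨r, hr, hxr⟩ := hD.2 x
    obtain ⟨e, he, rfl⟩ := List.mem_map.mp hr
    exact hx e he hxr
  obtain ⟨D, hD, hDs⟩ := key _ hd hd'
  obtain ⟨E, hE, hEs⟩ := key _ hr hr'
  obtain ⟨D', hl, hD'⟩ := hDs.exists_length_eq hD (le_max_left _ E.length)
  obtain ⟨E', hl', hE'⟩ := hEs.exists_length_eq hE (le_max_right D.length _)
  refine ⟨D'.zip E' ++ T, fun e he => List.mem_append_right _ he, ?_, ?_⟩
  · rwa [List.map_append, List.map_fst_zip (by omega)]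
  · rwa [List.map_append, List.map_snd_zip (by omega)]

theorem eq_of_mem_rect {P : PatternPair} {g : (Word × Word) × (Word × Word) → Word × Word}
    (h : IsSubdivision (P.map g)) {e e' : (Word × Word) × (Word × Word)} (he : e ∈ P)
    (he' : e' ∈ P) {x : CantorSq} (hx : x ∈ rect (g e)) (hx' : x ∈ rect (g e')) : e = e' := by
  by_contra hne
  have : Std.Symm fun e e' => Disjoint (rect (g e)) (rect (g e')) := ⟨fun _ _ h => h.symm⟩
  exact Set.disjoint_left.mp ((List.pairwise_map.mp h.1).forall he he' hne) hx hx'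

/-- The prefix replacements glue to a continuous map because the domain rectangles are open. The
range subdivision makes it bijective, and a continuous bijection from a compact space to a Hausdorff
space is a homeomorphism. -/
theorem exists_homeomorph_represents {P : PatternPair} (h1 : IsSubdivision (P.map Prod.fst))
    (h2 : IsSubdivision (P.map Prod.snd)) : ∃ f ∈ TwoV, P.Represents f := by
  have hcov : ∀ x : CantorSq, ∃ e ∈ P, x ∈ rect e.1 := fun x => by
    obtain ⟨r, hr, hx⟩ := h1.2 x
    obtain ⟨e, he, rfl⟩ := List.mem_map.mp hr
    exact ⟨e, he, hx⟩
  choose c hcP hc using hcov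
  let G : ((Word × Word) × (Word × Word)) → CantorSq → CantorSq := fun e x =>
    (cat e.2.1 (drop e.1.1.length x.1), cat e.2.2 (drop e.1.2.length x.2))
  have hG : ∀ e, Continuous (G e) := fun e =>
    ((continuous_cat _).comp ((continuous_drop _).comp continuous_fst)).prodMk
      ((continuous_cat _).comp ((continuous_drop _).comp continuous_snd))
  let F : CantorSq → CantorSq := fun x => G (c x) x
  have hFG : ∀ e ∈ P, ∀ x ∈ rect e.1, F x = G e x := fun e he x hx => by
    simp only [F, eq_of_mem_rect h1 he (hcP x) hx (hc x)]
  have hact : ∀ e ∈ P, ActsAsPrefixReplacement F e.1 e.2 := fun e he ψ ω => by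
    rw [hFG e he _ ⟨⟨ψ, rfl⟩, ω, rfl⟩]
    simp only [G, drop_cat]
  have hcont : Continuous F := continuous_iff_continuousAt.mpr fun x =>
    (hG (c x)).continuousAt.congr (Filter.eventually_of_mem
      ((isClopen_rect _).isOpen.mem_nhds (hc x)) fun y hy => (hFG _ (hcP x) y hy).symm)
  have hbij : Function.Bijective F := by
    constructor
    · intro x y hxy
      obtain ⟨⟨ψ, hψ⟩, ω, hω⟩ := hc x
      obtain ⟨⟨ψ', hψ'⟩, ω', hω'⟩ := hc y
      have hx : x = (cat (c x).1.1 ψ, cat (c x).1.2 ω) := (Prod.ext hψ hω).symm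
      have hy : y = (cat (c y).1.1 ψ', cat (c y).1.2 ω') := (Prod.ext hψ' hω').symm
      have hFx : F x = (cat (c x).2.1 ψ, cat (c x).2.2 ω) :=
        (congrArg F hx).trans (hact _ (hcP x) ψ ω)
      have hFy : F y = (cat (c y).2.1 ψ', cat (c y).2.2 ω') :=
        (congrArg F hy).trans (hact _ (hcP y) ψ' ω')
      have he : c x = c y := eq_of_mem_rect h2 (hcP x) (hcP y) (x := F x)
        (hFx ▸ ⟨⟨_, rfl⟩, _, rfl⟩) (hxy ▸ hFy ▸ ⟨⟨_, rfl⟩, _, rfl⟩)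
      rw [hFx, hFy, he, Prod.mk.injEq] at hxy
      rw [hx, hy, he, cat_injective _ hxy.1, cat_injective _ hxy.2]
    · intro y
      obtain ⟨r, hr, ⟨ψ, hψ⟩, ω, hω⟩ := h2.2 y
      obtain ⟨e, he, rfl⟩ := List.mem_map.mp hr
      exact ⟨_, (hact e he ψ ω).trans (Prod.ext hψ hω)⟩
  let f : CantorSq ≃ₜ CantorSq :=
    Continuous.homeoOfEquivCompactToT2 (f := Equiv.ofBijective F hbij) hcont
  refine ⟨f, ⟨_, h1, fun r hr => ?_⟩, h1, h2, hact⟩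
  obtain ⟨e, he, rfl⟩ := List.mem_map.mp hr
  exact ⟨e.2, hact e he⟩

end BrinThompson

/-! ### Coding words over a finite alphabet by binary words. -/

namespace BrinThompson

section Tokens

variable {A : Type*}

/-- One of the two words is a prefix of the other. -/
def Compat : List A → List A → Prop
  | a :: u, b :: v => a = b ∧ Compat u v
  | [], _ => True
  | _ :: _, [] => True

@[simp] theorem compat_cons_cons {a b : A} {u v : List A} :
    Compat (a :: u) (b :: v) ↔ a = b ∧ Compat u v := by simp [Compat]

@[simp] theorem compat_nil_left (v : List A) : Compat [] v := by simp [Compat]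

@[simp] theorem compat_nil_right (u : List A) : Compat u [] := by cases u <;> simp [Compat]

@[simp] theorem compat_append_left {w u v : List A} :
    Compat (w ++ u) (w ++ v) ↔ Compat u v := by
  induction w with
  | nil => rfl
  | cons a w ih => simp [ih]

theorem compat_self (u : List A) : Compat u u := by
  induction u with
  | nil => simp
  | cons a u ih => simp [ih]

/-- An injective block code for the letters of `A`, with `z` coded by a block of zeros. -/
structure BlockCode (A : Type*) (z : A) where
  len : ℕ
  len_pos : 0 < len
  blk : A → Word
  length_blk : ∀ a, (blk a).length = len
  injective : Function.Injective blk
  blk_zero : blk z = List.replicate len false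

theorem nonempty_blockCode [Finite A] (z : A) : Nonempty (BlockCode A z) := by
  classical
  obtain ⟨m, ⟨e⟩⟩ := Finite.exists_equiv_fin A
  -- One-hot coding, except that `z` gets the zero block.
  refine ⟨⟨m, ?_, fun a => List.ofFn fun i => decide (a ≠ z ∧ e a = i), by simp, ?_, ?_⟩⟩
  · exact (e z).pos
  · intro a b h
    have h' := List.ofFn_injective h
    have ha := congrFun h' (e a)
    have hb := congrFun h' (e b)
    simp only [decide_eq_decide, and_true, EmbeddingLike.apply_eq_iff_eq] at ha hb
    by_cases h1 : a = z
    · by_cases h2 : b = z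
      · rw [h1, h2]
      · exact (hb.mpr h2).2
    · exact (ha.mp h1).2.symm
  · simp only [ne_eq, not_true_eq_false, false_and, decide_false]
    exact List.ofFn_const m false

namespace BlockCode

variable {z : A} (c : BlockCode A z)

/-- The binary code of a word over `A`. -/
def enc (u : List A) : Word := u.flatMap c.blk

@[simp] theorem enc_nil : c.enc [] = [] := rfl

@[simp] theorem enc_cons (a : A) (u : List A) : c.enc (a :: u) = c.blk a ++ c.enc u := rfl

@[simp] theorem enc_append (u v : List A) : c.enc (u ++ v) = c.enc u ++ c.enc v :=
  List.flatMap_append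

/-- The binary codes of a pair of words over `A`. -/
def encPair (u : List A × List A) : Word × Word := (c.enc u.1, c.enc u.2)

theorem cat_blk_inj {a b : A} {ψ ω : Cantor} (h : cat (c.blk a) ψ = cat (c.blk b) ω) :
    a = b ∧ ψ = ω := by
  obtain ⟨v, hv⟩ := exists_append_of_cat_eq h (by simp [c.length_blk])
  have hl := congrArg List.length hv
  rw [List.length_append, c.length_blk, c.length_blk] at hl
  rw [List.length_eq_zero_iff.mp (by omega : v.length = 0), List.append_nil] at hv
  obtain rfl := c.injective hv
  exact ⟨rfl, cat_injective _ h⟩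

/-- Blocks have equal length and determine their letters, so two codes can be compared letter by
letter. Incompatible words therefore give disjoint rectangles. -/
theorem compat_of_cat_eq {u v : List A} {ψ ω : Cantor}
    (h : cat (c.enc u) ψ = cat (c.enc v) ω) : Compat u v := by
  induction u generalizing v with
  | nil => simp
  | cons a u ih =>
    cases v with
    | nil => simp
    | cons b v =>
      rw [enc_cons, enc_cons, cat_append, cat_append] at h
      obtain ⟨h1, h2⟩ := c.cat_blk_inj h
      exact compat_cons_cons.mpr ⟨h1, ih h2⟩

theorem disjoint_rect {u v : List A × List A} (h : ¬ (Compat u.1 v.1 ∧ Compat u.2 v.2)) :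
    Disjoint (rect (c.encPair u)) (rect (c.encPair v)) := by
  rw [Set.disjoint_left]
  rintro x ⟨⟨ψ, h1⟩, ω, h2⟩ ⟨⟨ψ', h3⟩, ω', h4⟩
  exact h ⟨c.compat_of_cat_eq (h1.trans h3.symm), c.compat_of_cat_eq (h2.trans h4.symm)⟩

/-- The dyadic point named by a pair of words over `A`. -/
def point (u : List A × List A) : CantorSq :=
  (cat (c.enc u.1) (fun _ => false), cat (c.enc u.2) (fun _ => false))

/-- Since `z` is coded by zeros, a growing block of letters `z` pushes everything behind it off to
infinity and leaves zeros. -/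
theorem tendsto_cat_enc_replicate (u v : List A) (ω : Cantor) :
    Filter.Tendsto (fun m => cat (c.enc (u ++ List.replicate m z ++ v)) ω) Filter.atTop
      (nhds (cat (c.enc u) (fun _ => false))) := by
  simp only [List.append_assoc, enc_append, cat_append]
  refine ((continuous_cat (c.enc u)).tendsto _).comp (tendsto_pi_nhds.mpr fun i => ?_)
  refine tendsto_const_nhds.congr' ?_
  filter_upwards [Filter.eventually_gt_atTop i] with m hm
  have h1 : c.enc (List.replicate m z) = List.replicate (m * c.len) false := by
    clear hm
    induction m with
    | zero => simp
    | succ m ih => rw [List.replicate_succ, enc_cons, ih, c.blk_zero, List.replicate_append_replicate,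
        Nat.succ_mul, Nat.add_comm]
  have h2 : i < m * c.len := hm.trans_le (Nat.le_mul_of_pos_right m c.len_pos)
  simp [h1, cat, h2]

end BlockCode

/-- One step of the rewriting system with rules `R` on the prefixes of pairs of words. -/
def PrefixStep (R : List A × List A → List A × List A → Prop) (z z' : List A × List A) : Prop :=
  ∃ d r : List A × List A, R d r ∧ ∃ u v, z = (d.1 ++ u, d.2 ++ v) ∧ z' = (r.1 ++ u, r.2 ++ v)

/-- A finite reversible system of prefix replacements is realized by an element of `2V`. -/
theorem exists_represents_of_rules {z : A} (c : BlockCode A z)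
    {R : List A × List A → List A × List A → Prop}
    (hfin : {e : (List A × List A) × (List A × List A) | R e.1 e.2}.Finite)
    (hdom : ∀ {d r d' r'}, R d r → R d' r' → Compat d.1 d'.1 → Compat d.2 d'.2 → d = d' ∧ r = r')
    (hran : ∀ {d r d' r'}, R d r → R d' r' → Compat r.1 r'.1 → Compat r.2 r'.2 → d = d' ∧ r = r')
    {a : A} (ha : ∀ {d r}, R d r → ¬ Compat [a] d.1 ∧ ¬ Compat [a] r.1) :
    ∃ f ∈ TwoV, ∃ P : PatternPair, P.Represents f ∧
      ∀ u v, PrefixStep R u v → f (c.point u) = c.point v := by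
  let L := hfin.toFinset.toList
  have hL : ∀ e, e ∈ L ↔ R e.1 e.2 := by simp [L]
  let T : PatternPair := L.map fun e => (c.encPair e.1, c.encPair e.2)
  have hnd : L.Nodup := Finset.nodup_toList _
  -- The letter `a` begins no first-tape prefix of a rule, so a point starting with its code is
  -- uncovered on both sides.
  have hx : ∀ w : List A × List A, ¬ Compat [a] w.1 →
      ((cat (c.enc [a]) fun _ => false, fun _ => false) : CantorSq) ∉ rect (c.encPair w) := by
    rintro w hw ⟨⟨ψ, hψ⟩, -⟩
    refine hw (c.compat_of_cat_eq (ψ := fun _ => false) (ω := ψ) ?_)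
    exact hψ.symm
  obtain ⟨P, hTP, h1, h2⟩ := exists_patternPair_extending (T := T)
    (List.pairwise_map.mpr (hnd.imp_of_mem fun {e e'} he he' hne => c.disjoint_rect fun h =>
      hne (Prod.ext_iff.mpr (hdom ((hL e).mp he) ((hL e').mp he') h.1 h.2))))
    (List.pairwise_map.mpr (hnd.imp_of_mem fun {e e'} he he' hne => c.disjoint_rect fun h =>
      hne (Prod.ext_iff.mpr (hran ((hL e).mp he) ((hL e').mp he') h.1 h.2))))
    ⟨(cat (c.enc [a]) fun _ => false, fun _ => false), fun e he => by
      obtain ⟨e, he', rfl⟩ := List.mem_map.mp he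
      exact hx _ (ha ((hL e).mp he')).1⟩
    ⟨(cat (c.enc [a]) fun _ => false, fun _ => false), fun e he => by
      obtain ⟨e, he', rfl⟩ := List.mem_map.mp he
      exact hx _ (ha ((hL e).mp he')).2⟩
  obtain ⟨f, hf, hP⟩ := exists_homeomorph_represents h1 h2
  refine ⟨f, hf, P, hP, ?_⟩
  rintro _ _ ⟨d, r, hR, u, v, rfl, rfl⟩
  have h := hP.2.2 _ (hTP _ (List.mem_map.mpr ⟨(d, r), (hL _).mpr hR, rfl⟩))
    (cat (c.enc u) fun _ => false) (cat (c.enc v) fun _ => false)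
  simpa only [BlockCode.point, BlockCode.encPair, BlockCode.enc_append, cat_append] using h

end Tokens

/-! ### Reversible simulation of a stack machine. -/

/-- The letters on the two tapes of the reversible simulation of a machine with states `Q` and
stacks `K` over the alphabet `Γ`. -/
inductive Tok (Q K Γ : Type) : Type
  | zero
  | start
  | sink
  | dead
  | hd (k : K)
  | sym (g : Γ)
  | main (q : Q)
  | fwd (q : Q)
  | back (q : Q) (o : Option Γ)
  | hist (q : Q) (o : Option Γ)

section Simulation

variable {Q K Γ : Type}

instance [Finite Q] [Finite K] [Finite Γ] : Finite (Tok Q K Γ) := by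
  let F : Tok Q K Γ → Fin 10 × Option Q × Option K × Option Γ := fun
    | .zero => (0, none, none, none)
    | .start => (1, none, none, none)
    | .sink => (2, none, none, none)
    | .dead => (3, none, none, none)
    | .hd k => (4, none, some k, none)
    | .sym g => (5, none, none, some g)
    | .main q => (6, some q, none, none)
    | .fwd q => (7, some q, none, none)
    | .back q o => (8, some q, none, o)
    | .hist q o => (9, some q, none, o)
  refine Finite.of_injective F fun a b h => ?_
  cases a <;> cases b <;> simp_all [F]

/-- One step of a machine with finitely many stacks: the state selects a stack, whose top is
replaced by a word. -/
def stackStep [DecidableEq K] (δ : Q → Option (K × (Option Γ → Q × List Γ))) :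
    Q × (K → List Γ) → Option (Q × (K → List Γ)) := fun c =>
  (δ c.1).map fun p => ((p.2 (c.2 p.1).head?).1,
    Function.update c.2 p.1 ((p.2 (c.2 p.1).head?).2 ++ (c.2 p.1).tail))

open Tok

/-- The reversible prefix replacement rules simulating a machine with finitely many stacks. The
second tape holds the contents of the stacks, the first tape the state, above the part of the
second tape that has been read, above the history of the computation. -/
inductive Rule (δ : Q → Option (K × (Option Γ → Q × List Γ))) :
    List (Tok Q K Γ) × List (Tok Q K Γ) → List (Tok Q K Γ) × List (Tok Q K Γ) → Prop
  | enter {q k g} : δ q = some (k, g) → Rule δ ([main q], []) ([fwd q, start], [])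
  | move {q k g t} : δ q = some (k, g) → t ≠ start → t ≠ hd k →
      Rule δ ([fwd q], [t]) ([fwd q, t], [])
  | actSym {q k g a} : δ q = some (k, g) →
      Rule δ ([fwd q], [hd k, sym a]) ([back q (some a)], hd k :: (g (some a)).2.map sym)
  | actEmpty {q k g t} : δ q = some (k, g) → (∀ a, t ≠ sym a) →
      Rule δ ([fwd q], [hd k, t]) ([back q none], hd k :: ((g none).2.map sym ++ [t]))
  | ret {q k g o t} : δ q = some (k, g) → t ≠ start → t ≠ hd k →
      Rule δ ([back q o, t], []) ([back q o], [t])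
  | exit {q k g o} : δ q = some (k, g) →
      Rule δ ([back q o, start], []) ([main (g o).1, hist q o], [])
  | halt {q} : δ q = none → Rule δ ([main q], []) ([sink, hist q none], [])
  | sink : Rule δ ([sink], []) ([sink, zero], [zero])

variable {δ : Q → Option (K × (Option Γ → Q × List Γ))}

/-- Determinism. The first letter of tape one gives the phase. Then `δ q` separates `enter` from
`halt`, the letter `hd k` separates moving from acting, the letter after it separates the two
actions, and `start` separates `exit` from `ret`. -/
theorem Rule.eq_of_compat_dom {d r d' r'} (h : Rule δ d r) (h' : Rule δ d' r')
    (h1 : Compat d.1 d'.1) (h2 : Compat d.2 d'.2) : d = d' ∧ r = r' := by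
  cases h <;> cases h' <;> first | (simp_all; done) | grind [compat_cons_cons]

/-- Reversibility. `start` separates `enter` from `move`, and `hd k` on top of tape two separates
acting from `ret`. The letter `back q o` remembers the symbol that was read, and `hist q o` the
state and symbol lost by `exit`. In the sink state, `hist` against `zero` separates the first
arrival from later steps. -/
theorem Rule.eq_of_compat_ran {d r d' r'} (h : Rule δ d r) (h' : Rule δ d' r')
    (h1 : Compat r.1 r'.1) (h2 : Compat r.2 r'.2) : d = d' ∧ r = r' := by
  cases h <;> cases h' <;> simp_all

theorem Rule.not_compat_dead {d r} (h : Rule δ d r) :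
    ¬ Compat [dead] d.1 ∧ ¬ Compat [dead] r.1 := by
  cases h <;> simp

/-- By determinism a rule is known from its left side, a pair of words of length at most two over a
finite alphabet. -/
theorem finite_rule [Finite Q] [Finite K] [Finite Γ]
    (δ : Q → Option (K × (Option Γ → Q × List Γ))) :
    {e : (List (Tok Q K Γ) × List (Tok Q K Γ)) × _ | Rule δ e.1 e.2}.Finite := by
  refine Set.Finite.of_injOn (f := Prod.fst)
    (t := {u | u.length ≤ 2} ×ˢ {u | u.length ≤ 2}) ?_ ?_
    ((List.finite_length_le _ 2).prod (List.finite_length_le _ 2))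
  · rintro ⟨d, r⟩ h
    change Rule δ d r at h
    cases h <;> simp
  · rintro ⟨d, r⟩ h ⟨d', r'⟩ h' (rfl : d = d')
    exact Prod.ext rfl (Rule.eq_of_compat_dom h h' (compat_self _) (compat_self _)).2

/-- The letters on the second tape when the stacks listed in `ks` hold `S`. -/
def stackTape (ks : List K) (S : K → List Γ) : List (Tok Q K Γ) :=
  ks.flatMap fun k => hd k :: (S k).map sym

theorem forwardPass {q k g} (hq : δ q = some (k, g)) (h r : List (Tok Q K Γ)) {u}
    (hu : ∀ t ∈ u, t ≠ start ∧ t ≠ hd k) :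
    Relation.ReflTransGen (PrefixStep (Rule δ)) (fwd q :: h, u ++ r)
      (fwd q :: (u.reverse ++ h), r) := by
  induction u generalizing h with
  | nil => exact .refl
  | cons t u ih =>
    have ht := hu t List.mem_cons_self
    refine .head ⟨_, _, Rule.move hq ht.1 ht.2, h, u ++ r, rfl, rfl⟩ ?_
    simpa using ih (t :: h) fun t ht => hu t (List.mem_cons_of_mem _ ht)

theorem backwardPass {q k g} (hq : δ q = some (k, g)) (o : Option Γ) (h r : List (Tok Q K Γ))
    {u} (hu : ∀ t ∈ u, t ≠ start ∧ t ≠ hd k) :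
    Relation.ReflTransGen (PrefixStep (Rule δ)) (back q o :: (u ++ h), r)
      (back q o :: h, u.reverse ++ r) := by
  induction u generalizing r with
  | nil => exact .refl
  | cons t u ih =>
    have ht := hu t List.mem_cons_self
    refine .head ⟨_, _, Rule.ret (o := o) hq ht.1 ht.2, u ++ h, r, rfl, rfl⟩ ?_
    simpa using ih (t :: r) fun t ht => hu t (List.mem_cons_of_mem _ ht)

theorem prefixStep_act {q k g} (hq : δ q = some (k, g)) (h : List (Tok Q K Γ)) (s : List Γ)
    {t : Tok Q K Γ} (ht : ∀ a, t ≠ sym a) (r : List (Tok Q K Γ)) :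
    PrefixStep (Rule δ) (fwd q :: h, hd k :: (s.map sym ++ t :: r))
      (back q s.head? :: h, hd k :: (((g s.head?).2 ++ s.tail).map sym ++ t :: r)) := by
  cases s with
  | nil => exact ⟨_, _, Rule.actEmpty hq ht, h, r, rfl, by simp⟩
  | cons a s => exact ⟨_, _, Rule.actSym hq, h, s.map sym ++ t :: r, rfl, by simp⟩

theorem stackTape_congr {ks : List K} {S S' : K → List Γ} (h : ∀ k ∈ ks, S k = S' k) :
    (stackTape ks S : List (Tok Q K Γ)) = stackTape ks S' := by
  induction ks with
  | nil => rfl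
  | cons k ks ih =>
    simp only [stackTape, List.flatMap_cons] at ih ⊢
    rw [h k List.mem_cons_self, ih fun k hk => h k (List.mem_cons_of_mem _ hk)]

theorem ne_of_mem_stackTape {ks : List K} {S : K → List Γ} {k : K} (hk : k ∉ ks)
    {t : Tok Q K Γ} (ht : t ∈ stackTape ks S) : t ≠ start ∧ t ≠ hd k := by
  simp only [stackTape, List.mem_flatMap, List.mem_cons, List.mem_map] at ht
  obtain ⟨k', hk', rfl | ⟨a, -, rfl⟩⟩ := ht
  · exact ⟨by simp, by simpa using fun h : k' = k => hk (h ▸ hk')⟩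
  · simp

/-- The final `zero` delimits the last stack, so that `actEmpty` always has a letter to see beyond
an empty stack. As `zero` is coded by zeros, it does not change the point. -/
theorem exists_stackTape_append_eq_cons (ks : List K) (S : K → List Γ) :
    ∃ (t : Tok Q K Γ) (r : List (Tok Q K Γ)),
      stackTape ks S ++ [zero] = t :: r ∧ ∀ a, t ≠ sym a := by
  cases ks with
  | nil => exact ⟨zero, [], rfl, by simp⟩
  | cons k ks => exact ⟨hd k, _, rfl, by simp⟩

variable [DecidableEq K]

/-- Each step of the stack machine is simulated by steps of the reversible rewriting system. -/
theorem transGen_of_stackStep {ks : List K} (hks : ks.Nodup) (hmem : ∀ k, k ∈ ks)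
    {q q' : Q} {S S' : K → List Γ} (hstep : stackStep δ (q, S) = some (q', S'))
    (h : List (Tok Q K Γ)) :
    ∃ h', Relation.TransGen (PrefixStep (Rule δ)) (main q :: h, stackTape ks S ++ [zero])
      (main q' :: h', stackTape ks S' ++ [zero]) := by
  obtain ⟨⟨k, g⟩, hq, hp⟩ := Option.map_eq_some_iff.mp hstep
  simp only [Prod.mk.injEq] at hp
  obtain ⟨rfl, rfl⟩ := hp
  obtain ⟨l₁, l₂, rfl⟩ := List.append_of_mem (hmem k)
  obtain ⟨hk₁, hk₂⟩ : k ∉ l₁ ∧ k ∉ l₂ := by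
    have := (List.nodup_middle.mp hks).notMem
    rwa [List.mem_append, not_or] at this
  set w := (g (S k).head?).2 ++ (S k).tail with hw
  have e₁ : stackTape l₁ (Function.update S k w) = (stackTape l₁ S : List (Tok Q K Γ)) :=
    stackTape_congr fun k' hk' => Function.update_of_ne (ne_of_mem_of_not_mem hk' hk₁) _ _
  have e₂ : stackTape l₂ (Function.update S k w) = (stackTape l₂ S : List (Tok Q K Γ)) :=
    stackTape_congr fun k' hk' => Function.update_of_ne (ne_of_mem_of_not_mem hk' hk₂) _ _
  obtain ⟨t, r, htr, ht⟩ := exists_stackTape_append_eq_cons (Q := Q) l₂ S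
  have split : ∀ S : K → List Γ, (stackTape (l₁ ++ k :: l₂) S ++ [zero] : List (Tok Q K Γ)) =
      stackTape l₁ S ++ hd k :: ((S k).map sym ++ (stackTape l₂ S ++ [zero])) := fun S => by
    simp [stackTape]
  rw [split, split, e₁, e₂, Function.update_self, htr]
  have hne : ∀ t ∈ (stackTape l₁ S : List (Tok Q K Γ)), t ≠ start ∧ t ≠ hd k :=
    fun t ht => ne_of_mem_stackTape hk₁ ht
  refine ⟨hist q (S k).head? :: h, ?_⟩
  -- The marker `start` keeps the history `h` below it untouched during the round trip and tells the
  -- returning head where to stop.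
  refine .head' ⟨_, _, Rule.enter hq, h, _, rfl, rfl⟩ ?_
  refine (forwardPass hq (start :: h) _ hne).trans ?_
  refine .head (prefixStep_act hq _ (S k) ht r) ?_
  refine (backwardPass hq _ (start :: h) _ fun t ht => hne t (List.mem_reverse.mp ht)).trans ?_
  rw [List.reverse_reverse]
  exact .single ⟨_, _, Rule.exit hq, h, _, rfl, rfl⟩

end Simulation
end BrinThompson

/-! ### Halting of the machine as convergence of an orbit. -/

namespace BrinThompson

open StateTransition Tok

theorem exists_iterate_of_transGen {A : Type*} {z : A} {c : BlockCode A z}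
    {R : List A × List A → List A × List A → Prop} {f : CantorSq → CantorSq}
    (hf : ∀ u v, PrefixStep R u v → f (c.point u) = c.point v) {u v : List A × List A}
    (h : Relation.TransGen (PrefixStep R) u v) : ∃ n, f^[n + 1] (c.point u) = c.point v := by
  induction h with
  | single h => exact ⟨0, hf _ _ h⟩
  | tail _ h ih =>
    obtain ⟨n, hn⟩ := ih
    exact ⟨n + 1, by rw [Function.iterate_succ_apply', hn, hf _ _ h]⟩

/-- For every machine with finitely many stacks there is an element of `2V` such that halting of
the machine is equivalent to convergence of an orbit. -/
theorem exists_orbitConvergesTo_iff_eval_dom {Q K Γ : Type} [Finite Q] [Finite K] [Finite Γ]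
    [DecidableEq K] (δ : Q → Option (K × (Option Γ → Q × List Γ))) {ks : List K} (hks : ks.Nodup)
    (hmem : ∀ k, k ∈ ks) :
    ∃ c : BlockCode (Tok Q K Γ) zero, ∃ f ∈ TwoV, ∃ P : PatternPair, P.Represents f ∧
      ∀ q S, OrbitConvergesTo f (c.point ([main q], stackTape ks S ++ [zero]))
        (c.point ([sink], [])) ↔ (eval (stackStep δ) (q, S)).Dom := by
  obtain ⟨c⟩ := nonempty_blockCode (zero : Tok Q K Γ)
  obtain ⟨f, hf2, P, hP, hf⟩ := exists_represents_of_rules c (finite_rule δ)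
    Rule.eq_of_compat_dom Rule.eq_of_compat_ran Rule.not_compat_dead
  refine ⟨c, f, hf2, P, hP, fun q S => ⟨fun hconv => ?_, fun hdom => ?_⟩⟩
  · by_contra hnd
    have hstep : ∀ s, Reaches (stackStep δ) (q, S) s → ∃ s', stackStep δ s = some s' :=
      fun s hs => Option.ne_none_iff_exists'.mp fun h =>
        hnd (Part.dom_iff_mem.mpr ⟨s, mem_eval.mpr ⟨hs, h⟩⟩)
    -- Each machine step costs at least one iterate, so a run that never halts visits `main`
    -- configurations at arbitrarily late times.
    have hrun : ∀ n, ∃ N ≥ n, ∃ s h, Reaches (stackStep δ) (q, S) s ∧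
        (⇑f)^[N] (c.point ([main q], stackTape ks S ++ [zero])) =
          c.point (main s.1 :: h, stackTape ks s.2 ++ [zero]) := by
      intro n
      induction n with
      | zero => exact ⟨0, le_rfl, (q, S), [], .refl, rfl⟩
      | succ n ih =>
        obtain ⟨N, hN, s, h, hs, hfs⟩ := ih
        obtain ⟨s', hs'⟩ := hstep s hs
        obtain ⟨h', hT⟩ := transGen_of_stackStep hks hmem hs' h
        obtain ⟨m, hm⟩ := exists_iterate_of_transGen hf hT
        exact ⟨m + 1 + N, by omega, s', h', hs.tail hs', by
          rw [Function.iterate_add_apply, hfs, hm]⟩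
    have hnhds : rect (c.encPair ([sink], [])) ∈ nhds (c.point ([sink], [])) :=
      (isClopen_rect _).isOpen.mem_nhds ⟨⟨fun _ => false, rfl⟩, fun _ => false, rfl⟩
    obtain ⟨n, hn⟩ := Filter.eventually_atTop.mp (hconv.eventually hnhds)
    obtain ⟨N, hN, s, h, -, hfs⟩ := hrun n
    have hrect := hn N hN
    rw [hfs] at hrect
    obtain ⟨⟨ψ, hψ⟩, -⟩ := hrect
    have : Compat [sink] (main s.1 :: h) :=
      c.compat_of_cat_eq (ψ := ψ) (ω := fun _ => false) hψ
    simp at this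
  · obtain ⟨s, hmem_eval⟩ := Part.dom_iff_mem.mp hdom
    obtain ⟨hs, hnone⟩ := mem_eval.mp hmem_eval
    have hrun : ∃ N h, (⇑f)^[N] (c.point ([main q], stackTape ks S ++ [zero])) =
        c.point (main s.1 :: h, stackTape ks s.2 ++ [zero]) := by
      clear hnone hmem_eval
      induction hs with
      | refl => exact ⟨0, [], rfl⟩
      | tail _ hs' ih =>
        obtain ⟨N, h, hfs⟩ := ih
        obtain ⟨h', hT⟩ := transGen_of_stackStep hks hmem hs' h
        obtain ⟨m, hm⟩ := exists_iterate_of_transGen hf hT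
        exact ⟨m + 1 + N, h', by rw [Function.iterate_add_apply, hfs, hm]⟩
    obtain ⟨N, h, hN⟩ := hrun
    -- One iterate enters the sink; each later one inserts a `zero` on both tapes, behind `sink` on
    -- the first.
    have hsink : ∀ m, (⇑f)^[m + (1 + N)] (c.point ([main q], stackTape ks S ++ [zero])) =
        c.point ([sink] ++ List.replicate m zero ++ hist s.1 none :: h,
          [] ++ List.replicate m zero ++ (stackTape ks s.2 ++ [zero])) := by
      intro m
      induction m with
      | zero =>
        rw [Nat.zero_add, Function.iterate_add_apply, hN]
        exact hf _ _ ⟨_, _, Rule.halt (Option.map_eq_none_iff.mp hnone), h, _, rfl, rfl⟩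
      | succ m ih =>
        rw [Nat.succ_add, Function.iterate_succ_apply', ih]
        exact hf _ _ ⟨_, _, Rule.sink, _, _, rfl, rfl⟩
    refine (Filter.tendsto_add_atTop_iff_nat (1 + N)).mp ?_
    simp only [hsink]
    exact (c.tendsto_cat_enc_replicate _ _ _).prodMk_nhds (c.tendsto_cat_enc_replicate _ _ _)

end BrinThompson

/-! ### From `TM2` machines to stack machines with finitely many states. -/

namespace BrinThompson

open StateTransition

section StackMachine

open Turing.TM2

variable {K Γ Λ σ : Type} (k₀ : K) (M : Λ → Stmt (fun _ : K => Γ) Λ σ)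

/-- The single instructions of a `TM2` machine, as moves of a stack machine whose states are the
statements still to be executed with the value of the local variable. Instructions without access
to the stacks look at the stack `k₀`. -/
def stmtMove :
    Option (Stmt (fun _ : K => Γ) Λ σ) → σ →
      Option (K × (Option Γ → (Option (Stmt (fun _ : K => Γ) Λ σ) × σ) × List Γ))
  | none, _ => none
  | some (.push k f q), v => some (k, fun o => ((some q, v), f v :: o.toList))
  | some (.peek k f q), v => some (k, fun o => ((some q, f v o), o.toList))
  | some (.pop k f q), v => some (k, fun o => ((some q, f v o), []))
  | some (.load a q), v => some (k₀, fun o => ((some q, a v), o.toList))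
  | some (.branch p q₁ q₂), v => some (k₀, fun o => ((some (cond (p v) q₁ q₂), v), o.toList))
  | some (.goto l), v => some (k₀, fun o => ((some (M (l v)), v), o.toList))
  | some .halt, v => some (k₀, fun o => ((none, v), o.toList))

variable (S : Finset Λ)

open Classical in
/-- The retraction of all statements onto those accessible from the labels in `S`. -/
noncomputable def toStmts (s : Option (Stmt (fun _ : K => Γ) Λ σ)) : {s // s ∈ stmts M S} :=
  if h : s ∈ stmts M S then ⟨s, h⟩ else ⟨none, Finset.none_mem_insertNone⟩

/-- The restriction of `stmtMove` to the statements accessible from the labels in `S`. -/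
noncomputable def stmtMoveOn (q : {s // s ∈ stmts M S} × σ) :
    Option (K × (Option Γ → ({s // s ∈ stmts M S} × σ) × List Γ)) :=
  (stmtMove k₀ M q.1.1 q.2).map fun p =>
    (p.1, fun o => ((toStmts M S (p.2 o).1.1, (p.2 o).1.2), (p.2 o).2))

variable {M S}

theorem toStmts_val {s : Option (Stmt (fun _ : K => Γ) Λ σ)} (h : s ∈ stmts M S) :
    (toStmts M S s).1 = s := by
  simp [toStmts, h]

theorem supportsStmt_of_mem_stmts (hS : ∀ l ∈ S, SupportsStmt S (M l))
    {q : Stmt (fun _ : K => Γ) Λ σ} (hq : some q ∈ stmts M S) : SupportsStmt S q := by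
  simp only [stmts, Finset.mem_insertNone, Finset.mem_biUnion, Option.mem_def, Option.some.injEq,
    forall_eq'] at hq
  obtain ⟨l, hl, h⟩ := hq
  exact stmts₁_supportsStmt_mono h (hS l hl)

theorem some_mem_stmts {l : Λ} (hl : l ∈ S) : some (M l) ∈ stmts M S := by
  simp only [stmts, Finset.mem_insertNone, Finset.mem_biUnion, Option.mem_def, Option.some.injEq,
    forall_eq']
  exact ⟨l, hl, stmts₁_self⟩

variable [DecidableEq K]

theorem update_head?_toList_append_tail (T : K → List Γ) (k : K) :
    Function.update T k ((T k).head?.toList ++ (T k).tail) = T := by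
  have : (T k).head?.toList ++ (T k).tail = T k := by cases T k <;> rfl
  rw [this, Function.update_eq_self]

/-- A configuration of the `TM2` machine and the corresponding one of the stack machine. -/
def Corresponds (c : Cfg (fun _ : K => Γ) Λ σ)
    (s : ({s // s ∈ stmts M S} × σ) × (K → List Γ)) : Prop :=
  s.1.1.1 = c.l.map M ∧ s.1.2 = c.var ∧ s.2 = c.stk

/-- A `TM2` step executes a whole statement, and each instruction in it touches at most one stack,
so it is one move. Induction on the statement chains these moves. The support condition keeps jumps
inside the statements accessible from `S`, a finite set, as finitely many tape letters require. -/
theorem exists_corresponds_stepAux (hS : ∀ l ∈ S, SupportsStmt S (M l))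
    {q : Stmt (fun _ : K => Γ) Λ σ} (hq : some q ∈ stmts M S) (v : σ) (T : K → List Γ) :
    ∃ s, Corresponds (M := M) (S := S) (stepAux q v T) s ∧
      Reaches₁ (stackStep (stmtMoveOn k₀ M S)) ((toStmts M S (some q), v), T) s := by
  have one : ∀ {q v T p}, some q ∈ stmts M S → stmtMove k₀ M (some q) v = some p →
      ((toStmts M S (p.2 (T p.1).head?).1.1, (p.2 (T p.1).head?).1.2),
        Function.update T p.1 ((p.2 (T p.1).head?).2 ++ (T p.1).tail)) ∈
      stackStep (stmtMoveOn k₀ M S) ((toStmts M S (some q), v), T) := by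
    intro q v T p hq hp
    simp [stackStep, stmtMoveOn, toStmts_val hq, hp]
  induction q generalizing v T with
  | push k f q ih =>
    obtain ⟨s, hs, hr⟩ := ih (stmts_trans (by simp [stmts₁, stmts₁_self]) hq) v
      (Function.update T k (f v :: T k))
    refine ⟨s, hs, .head (one hq rfl) ?_⟩
    have : (T k).head?.toList ++ (T k).tail = T k := by cases T k <;> rfl
    simpa [this, Reaches₁] using hr
  | peek k f q ih =>
    obtain ⟨s, hs, hr⟩ := ih (stmts_trans (by simp [stmts₁, stmts₁_self]) hq) (f v (T k).head?) T
    refine ⟨s, hs, .head (one hq rfl) ?_⟩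
    simpa only [update_head?_toList_append_tail, Reaches₁] using hr
  | pop k f q ih =>
    obtain ⟨s, hs, hr⟩ := ih (stmts_trans (by simp [stmts₁, stmts₁_self]) hq) (f v (T k).head?)
      (Function.update T k (T k).tail)
    exact ⟨s, hs, .head (one hq rfl) hr⟩
  | load a q ih =>
    obtain ⟨s, hs, hr⟩ := ih (stmts_trans (by simp [stmts₁, stmts₁_self]) hq) (a v) T
    refine ⟨s, hs, .head (one hq rfl) ?_⟩
    simpa only [update_head?_toList_append_tail, Reaches₁] using hr
  | branch p q₁ q₂ ih₁ ih₂ =>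
    have h := one (v := v) (T := T) hq rfl
    simp only [update_head?_toList_append_tail] at h
    simp only [stepAux]
    cases hp : p v
    · obtain ⟨s, hs, hr⟩ := ih₂ (stmts_trans (by simp [stmts₁, stmts₁_self]) hq) v T
      exact ⟨s, hs, .head h (by simpa [hp, Reaches₁] using hr)⟩
    · obtain ⟨s, hs, hr⟩ := ih₁ (stmts_trans (by simp [stmts₁, stmts₁_self]) hq) v T
      exact ⟨s, hs, .head h (by simpa [hp, Reaches₁] using hr)⟩
  | goto l =>
    have h := one (v := v) (T := T) hq rfl
    simp only [update_head?_toList_append_tail] at h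
    exact ⟨_, ⟨toStmts_val (some_mem_stmts (supportsStmt_of_mem_stmts hS hq v)), rfl, rfl⟩,
      .single h⟩
  | halt =>
    have h := one (v := v) (T := T) hq rfl
    simp only [update_head?_toList_append_tail] at h
    exact ⟨_, ⟨toStmts_val Finset.none_mem_insertNone, rfl, rfl⟩, .single h⟩

theorem respects_corresponds (hS : ∀ l ∈ S, SupportsStmt S (M l)) :
    Respects (step M) (stackStep (stmtMoveOn k₀ M S)) Corresponds := by
  rintro ⟨l, v, T⟩ ⟨⟨⟨q, hq⟩, v'⟩, T'⟩ ⟨h1, h2, h3⟩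
  simp only at h1 h2 h3
  subst h1 h2 h3
  cases l with
  | none => rfl
  | some l =>
    obtain ⟨s, hs, hr⟩ := exists_corresponds_stepAux k₀ hS hq v' T'
    refine ⟨s, hs, ?_⟩
    have : toStmts M S (some (M l)) = ⟨some (M l), hq⟩ := Subtype.ext (toStmts_val hq)
    rwa [this] at hr

end StackMachine

/-! ### Computability of the input and a universal machine. -/

section Input

open Turing.PartrecToTM2

theorem trNat_of_ne_zero {n : ℕ} (hn : n ≠ 0) :
    trNat n = (if n % 2 = 1 then Γ'.bit1 else Γ'.bit0) :: trNat (n / 2) := by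
  have hbit : Nat.bit (decide (n % 2 = 1)) (n / 2) = n := by
    rw [Nat.bit_val]
    rcases Nat.mod_two_eq_zero_or_one n with h | h <;> simp [h] <;> omega
  have h := Num.ofNat'_bit (decide (n % 2 = 1)) (n / 2)
  rw [hbit, Num.ofNat'_eq, Num.ofNat'_eq] at h
  have h0 : ((n / 2 : ℕ) : Num) = 0 → n / 2 = 0 := fun h => by
    simpa using congrArg (fun m : Num => (m : ℕ)) h
  rw [trNat, h, trNat]
  by_cases hn2 : n % 2 = 1
  · simp only [hn2, decide_true, cond_true, if_true]
    cases hm : ((n / 2 : ℕ) : Num) <;> rfl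
  · simp only [hn2, decide_false, cond_false, if_false]
    cases hm : ((n / 2 : ℕ) : Num) with
    | zero => have := h0 hm; omega
    | pos p => rfl

/-- Course-of-values recursion from `n / 2` to `n`. Nothing is asked of `φ`, since only its two
values at `Γ'.bit0` and `Γ'.bit1` occur. -/
theorem primrec_trNat_flatMap (φ : Γ' → Word) : Primrec fun n => (trNat n).flatMap φ := by
  have h : Primrec₂ fun (_ : Unit) n => (trNat n).flatMap φ := by
    -- The list `l` holds the values at all smaller arguments, so its length is the current
    -- argument.
    refine Primrec.nat_strong_rec _ (g := fun _ l => if l.length = 0 then some [] else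
      (l[l.length / 2]?).map fun w =>
        (if l.length % 2 = 1 then φ Γ'.bit1 else φ Γ'.bit0) ++ w) ?_ ?_
    · have hlen : Primrec fun p : Unit × List Word => p.2.length :=
        Primrec.list_length.comp Primrec.snd
      refine Primrec.ite (Primrec.eq.comp hlen (Primrec.const 0)) (Primrec.const _) ?_
      refine Primrec.option_map (Primrec.list_getElem?.comp Primrec.snd
        (Primrec.nat_div.comp hlen (Primrec.const 2))) ?_
      refine Primrec.list_append.comp (Primrec.ite (Primrec.eq.comp (Primrec.nat_mod.comp
        (hlen.comp Primrec.fst) (Primrec.const 2)) (Primrec.const 1)) (Primrec.const _)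
        (Primrec.const _)) Primrec.snd
    · intro _ n
      by_cases hn : n = 0
      · simp [hn]
      · have : n / 2 < n := by omega
        rw [trNat_of_ne_zero hn]
        simp only [List.length_map, List.length_range, hn, if_false, List.getElem?_map,
          List.getElem?_range this, Option.map_some, List.flatMap_cons]
        split_ifs <;> rfl
  exact h.comp (Primrec.const ()) Primrec.id

/-- The halting problem is solved by the halting of a single `TM2` machine on numerical input. -/
theorem exists_eval_init_dom_iff :
    ∃ c : Turing.ToPartrec.Code, ∀ a : Nat.Partrec.Code,
      (StateTransition.eval (Turing.TM2.step tr) (init c [Encodable.encode a])).Dom ↔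
        (a.eval 0).Dom := by
  have hU : Partrec fun n : ℕ => (Denumerable.ofNat Nat.Partrec.Code n).eval 0 :=
    Nat.Partrec.Code.eval_part.comp (Computable.ofNat _) (Computable.const 0)
  obtain ⟨c, hc⟩ := Turing.ToPartrec.Code.exists_code (Nat.Partrec'.part_iff₁.mpr hU)
  refine ⟨c, fun a => ?_⟩
  have h := hc (List.Vector.cons (Encodable.encode a) List.Vector.nil)
  rw [List.Vector.head_cons, Denumerable.ofNat_encode] at h
  rw [Turing.PartrecToTM2.tr_eval]
  change (c.eval [Encodable.encode a]).Dom ↔ _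
  change c.eval [Encodable.encode a] = _ at h
  rw [h]
  rfl

end Input

/-! ### The reduction from the halting problem. -/

theorem isDyadic_of_names {u : Word × Word} {p : CantorSq} (h : Names u p) : IsDyadic p := by
  have key : ∀ w : Word, {n | cat w (fun _ => false) n = true}.Finite := fun w =>
    (Set.finite_lt_nat w.length).subset fun n hn => by
      by_contra hlt
      simp only [Set.mem_ofPred_eq, not_lt] at hlt hn
      simp [cat, hlt.not_gt] at hn
  subst h
  exact ⟨key _, key _⟩

end BrinThompson

open BrinThompson Turing.PartrecToTM2 in
theorem mainTheorem8 :
    ¬ ∃ A : BrinThompson.PatternPair × (BrinThompson.Word × BrinThompson.Word) ×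
          (BrinThompson.Word × BrinThompson.Word) →. Bool,
        Partrec A ∧ BrinThompson.DecidesOrbitConvergence A := by
  rintro ⟨A, hA, hdec⟩
  obtain ⟨c, hc⟩ := exists_eval_init_dom_iff
  let S := codeSupp c Cont'.halt
  have hS : trNormal c Cont'.halt ∈ S ∧ ∀ l ∈ S, Turing.TM2.SupportsStmt S (tr l) :=
    tr_supports c Cont'.halt
  let ks : List K' := [.main, .rev, .aux, .stack]
  have : Finite K' := Finite.of_surjective (fun i : Fin 4 => ks[i]) fun k => by
    cases k
    exacts [⟨0, rfl⟩, ⟨1, rfl⟩, ⟨2, rfl⟩, ⟨3, rfl⟩]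
  -- The choice of `b`, `f` and `P` is not effective, which is harmless: they are fixed once and
  -- enter the reduction as constants.
  obtain ⟨b, f, hf, P, hP, hconv⟩ := exists_orbitConvergesTo_iff_eval_dom
    (stmtMoveOn K'.main tr S) (ks := ks) (by decide) (by intro k; cases k <;> decide)
  let q := (toStmts tr S (some (tr (trNormal c Cont'.halt))), (none : Option Γ'))
  let T : ℕ → K' → List Γ' := fun n => K'.elim (trList [n]) [] [] []
  let u : ℕ → Word × Word := fun n => b.encPair ([.main q], stackTape ks (T n) ++ [.zero])
  let v : Word × Word := b.encPair ([.sink], [])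
  have hu : Computable u := by
    refine (Computable.const (b.enc [.main q])).pair ?_
    -- Only the digits on the main stack depend on `n`; the rest of the initial tape is constant.
    have h : Primrec fun n => (b.blk (.hd .main) ++
        (trNat n).flatMap fun g => b.blk (.sym g)) ++
        b.enc ([.sym .cons, .hd .rev, .hd .aux, .hd .stack, .zero]) :=
      Primrec.list_append.comp (Primrec.list_append.comp (Primrec.const _)
        (primrec_trNat_flatMap _)) (Primrec.const _)
    refine h.to_comp.of_eq fun n => ?_
    simp [T, ks, stackTape, trList, BlockCode.enc, List.flatMap_map]
  have key : ∀ a : Nat.Partrec.Code, ∃ r ∈ A (P, u (Encodable.encode a), v),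
      (r = true ↔ (a.eval 0).Dom) := by
    intro a
    obtain ⟨r, hr, hiff⟩ := hdec f hf _ _ (isDyadic_of_names rfl) (isDyadic_of_names rfl) P
      (u (Encodable.encode a)) v hP rfl rfl
    refine ⟨r, hr, hiff.trans ((hconv q (T (Encodable.encode a))).trans ?_)⟩
    rw [← hc a]
    exact StateTransition.tr_eval_dom (respects_corresponds K'.main hS.2)
      ⟨toStmts_val (some_mem_stmts hS.1), rfl, rfl⟩
  classical
  refine ComputablePred.halting_problem 0 ⟨inferInstance, ?_⟩
  have hcomp : Partrec fun a : Nat.Partrec.Code => A (P, u (Encodable.encode a), v) :=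
    hA.comp ((Computable.const P).pair ((hu.comp Computable.encode).pair (Computable.const v)))
  refine hcomp.of_eq fun a => ?_
  obtain ⟨r, hr, hiff⟩ := key a
  rw [Part.eq_some_iff.mpr hr]
  exact congrArg Part.some
    (Bool.eq_iff_iff.mpr (hiff.trans (decide_eq_true_iff (p := (a.eval 0).Dom)).symm))
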